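/- All graphs are finite and simple. A dominating set of a graph $G$ is a set $D \subseteq V(G)$ such that every vertex of $V(G) \setminus D$ is adjacent to at least one vertex of $D$. The TARS-graph $\varepsilon(G)$ has the dominating sets of $G$ as its vertices; two of them, $X$ and $Y$, are adjacent if and only if either $Y$ is obtained from $X$ by adding or deleting a single vertex of $G$, or there are vertices $a \in X$ and $b \in Y \setminus X$ that are adjacent in $G$ and satisfy $Y = (X \cup \{b\}) \setminus \{a\}$. A graph on $n$ vertices is pancyclic if it contains a cycle of length $\ell$ for every integer $\ell$ with $3 \le \ell \le n$. For a graph $H$ with distinct vertices $u$, $v$, $x$ such that $N(u) = \{x, v\}$ and $N(v) = \{u\}$, the graph $H' = H - \{u, v\}$ is said to be obtained from $H$ by Operation A. **Corollary (Operation A without connectedness).** Let $H$ and $H'$ be graphs such that $H'$ is obtained from $H$ by Operation A; $H'$ is not required to be connected or to have at least two vertices. If $\varepsilon(H')$ is pancyclic, then $\varepsilon(H)$ is also pancyclic. -/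

import Mathlib

namespace TARS

/-- `D` is a dominating set of `G`: every vertex outside `D` is adjacent to a vertex of `D`. -/
def IsDominating {V : Type*} (G : SimpleGraph V) (D : Set V) : Prop :=
  ∀ w, w ∉ D → ∃ d ∈ D, G.Adj w d

/-- Token addition/removal: `Y` is obtained from `X` by adding or deleting a single vertex. -/
def TARStep {V : Type*} (X Y : Set V) : Prop :=
  (∃ w, w ∉ X ∧ Y = X ∪ {w}) ∨ (∃ w, w ∈ X ∧ Y = X \ {w})

/-- Token sliding: `Y = (X ∪ {b}) \ {a}` for adjacent vertices `a ∈ X` and `b ∈ Y \ X`. -/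
def TSStep {V : Type*} (G : SimpleGraph V) (X Y : Set V) : Prop :=
  ∃ a ∈ X, ∃ b ∈ Y \ X, G.Adj a b ∧ Y = (X ∪ {b}) \ {a}

theorem TARStep.symm {V : Type*} {X Y : Set V} (h : TARStep X Y) : TARStep Y X := by
  rcases h with ⟨w, hw, rfl⟩ | ⟨w, hw, rfl⟩
  · refine Or.inr ⟨w, by simp, ?_⟩
    ext z
    by_cases hz : z = w
    · subst hz; simp [hw]
    · simp [hz]
  · refine Or.inl ⟨w, by simp, ?_⟩
    ext z
    by_cases hz : z = w
    · subst hz; simp [hw]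
    · simp [hz]

theorem TSStep.symm {V : Type*} {G : SimpleGraph V} {X Y : Set V} (h : TSStep G X Y) :
    TSStep G Y X := by
  obtain ⟨a, ha, b, ⟨hbY, hbX⟩, hab, hY⟩ := h
  refine ⟨b, hbY, a, ⟨ha, by simp [hY]⟩, hab.symm, ?_⟩
  ext z
  by_cases hza : z = a
  · subst hza; simp [ha, hab.ne]
  · by_cases hzb : z = b
    · subst hzb; simp [hbX]
    · simp [hY, hza, hzb]

theorem not_TARStep_self {V : Type*} (X : Set V) : ¬ TARStep X X := by
  rintro (⟨w, hw, h⟩ | ⟨w, hw, h⟩)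
  · exact hw (h ▸ (by simp : w ∈ X ∪ {w}))
  · rw [h] at hw; exact hw.2 rfl

theorem not_TSStep_self {V : Type*} (G : SimpleGraph V) (X : Set V) : ¬ TSStep G X X := by
  rintro ⟨a, _, b, hb, _⟩
  exact hb.2 hb.1

/-- The TARS-graph of `G`: its vertices are the dominating sets of `G`, and two of them are
adjacent if and only if they differ by a token addition/removal or by a token slide. -/
def tarsGraph {V : Type*} (G : SimpleGraph V) : SimpleGraph {D : Set V // IsDominating G D} where
  Adj X Y := TARStep X.1 Y.1 ∨ TSStep G X.1 Y.1
  symm := ⟨fun _ _ h => h.imp TARStep.symm TSStep.symm⟩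
  loopless := ⟨fun X h => h.elim (not_TARStep_self X.1) (not_TSStep_self G X.1)⟩

/-- A finite graph on `n` vertices is pancyclic if it contains a cycle of every length `ℓ` with
`3 ≤ ℓ ≤ n`. -/
def IsPancyclic {W : Type*} [Finite W] (G : SimpleGraph W) : Prop :=
  ∀ ℓ : ℕ, 3 ≤ ℓ → ℓ ≤ Nat.card W → ∃ (w : W) (c : G.Walk w w), c.IsCycle ∧ c.length = ℓ

/-- `H'` is obtained from `H` by Operation A: there are distinct vertices `u`, `v`, `x` of `H` with
`N(u) = {x, v}` and `N(v) = {u}`, and `H'` is (isomorphic to) `H - {u, v}`, the subgraph of `H`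
induced by all vertices other than `u` and `v`. -/
def IsOperationA {V V' : Type*} (H : SimpleGraph V) (H' : SimpleGraph V') : Prop :=
  ∃ u v x : V, u ≠ v ∧ u ≠ x ∧ v ≠ x ∧ H.neighborSet u = {x, v} ∧ H.neighborSet v = {u} ∧
    Nonempty (H' ≃g H.induce ({u, v}ᶜ : Set V))

end TARS

/-!
Sort the dominating sets of `H` by their trace on `{u, v}`, which is `{u}`, `{u, v}` or `{v}`. Every
dominating set `X` of `H'` yields a column, the triangle formed by `X ∪ {u}`, `X ∪ {u, v}` and
`X ∪ {v}`. The only other dominating sets of `H` are `(X \ {x}) ∪ {u}` and `(X \ {x}) ∪ {u, v}`,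
where `X` dominates `H'` and `X \ {x}` misses only `x`; they are attached to the column of `X`.
A Hamiltonian path of `ε(H')`, which exists when `ε(H')` is pancyclic, is then followed forwards
along the sets containing `u` and backwards along the sets `X ∪ {v}`. The vertices used in each
column and the point of return can be varied so that all cycle lengths occur; missing exactly one
vertex may require the slide from `u` to `x` in the last column.
-/

namespace TARS

open SimpleGraph

section Pancyclic

variable {W W' : Type*} {G : SimpleGraph W}

theorem isPath_append_cons {a b c d : W} {p : G.Walk a b} {q : G.Walk c d} (hp : p.IsPath)
    (hq : q.IsPath) (h : G.Adj b c) (hpq : p.support.Disjoint q.support) :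
    (p.append (.cons h q)).IsPath := by
  rw [Walk.isPath_def, Walk.support_append, Walk.support_cons, List.tail_cons, List.nodup_append']
  exact ⟨hp.support_nodup, hq.support_nodup, hpq⟩

theorem isCycle_cons_of_two_le_length {a b : W} {p : G.Walk a b} (hp : p.IsPath)
    (h : G.Adj b a) (hlen : 2 ≤ p.length) : (Walk.cons h p).IsCycle := by
  rw [Walk.isCycle_iff_isPath_tail_and_le_length]
  exact ⟨by simpa using hp, by simpa using hlen⟩

theorem isHamiltonian_toWalk_of_card_le_two [Finite W] [DecidableEq W] {a b : W} (h : G.Adj a b)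
    (hcard : Nat.card W ≤ 2) : h.toWalk.IsHamiltonian := by
  have := Fintype.ofFinite W
  have : 1 < Fintype.card W := Fintype.one_lt_card_iff.2 ⟨a, b, h.ne⟩
  rw [Nat.card_eq_fintype_card] at hcard
  rw [Walk.isHamiltonian_iff_isPath_and_length_eq]
  exact ⟨.of_adj h, by simp only [Walk.length_cons, Walk.length_nil]; omega⟩

theorem IsPancyclic.exists_isHamiltonianCycle [Finite W] [DecidableEq W] (hG : IsPancyclic G)
    (hcard : 3 ≤ Nat.card W) : ∃ (w : W) (c : G.Walk w w), c.IsHamiltonianCycle := by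
  have := Fintype.ofFinite W
  obtain ⟨w, c, hc, hlen⟩ := hG _ hcard le_rfl
  exact ⟨w, c, Walk.isHamiltonianCycle_iff_isCycle_and_length_eq.2
    ⟨hc, hlen.trans Nat.card_eq_fintype_card⟩⟩

theorem IsPancyclic.map [Finite W] [Finite W'] {G' : SimpleGraph W'} (hG : IsPancyclic G)
    (f : G →g G') (hf : Function.Bijective f) : IsPancyclic G' := by
  intro k hk3 hk
  obtain ⟨w, c, hc, hlen⟩ := hG k hk3 (hk.trans_eq (Nat.card_eq_of_bijective f hf).symm)
  exact ⟨f w, c.map f, hc.map hf.injective, by simpa using hlen⟩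

end Pancyclic

section ColumnGraph

/-- The vertices of one column of a column graph: two `rail` vertices and one `mid` vertex, and, if
`P` holds, two further `spur` vertices. -/
inductive Column (P : Prop) : Type
  | rail (b : Bool)
  | mid
  | spur (b : Bool) (h : P)

namespace Column

def equivSum (P : Prop) : Column P ≃ Option Bool ⊕ Bool × PLift P where
  toFun
    | rail b => .inl (some b)
    | mid => .inl none
    | spur b h => .inr (b, ⟨h⟩)
  invFun
    | .inl (some b) => rail b
    | .inl none => mid
    | .inr (b, h) => spur b h.down
  left_inv := by rintro (_ | _ | _) <;> rfl
  right_inv := by rintro ((_ | _) | _) <;> rfl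

instance (P : Prop) : Finite (Column P) :=
  Finite.of_equiv _ (equivSum P).symm

theorem card_of_pos {P : Prop} (h : P) : Nat.card (Column P) = 5 := by
  have : Unique (PLift P) := ⟨⟨⟨h⟩⟩, fun _ => rfl⟩
  simp [Nat.card_congr (equivSum P)]

theorem card_of_neg {P : Prop} (h : ¬ P) : Nat.card (Column P) = 3 := by
  have : IsEmpty (PLift P) := ⟨fun h' => h h'.down⟩
  simp [Nat.card_congr (equivSum P)]

theorem three_le_card (P : Prop) : 3 ≤ Nat.card (Column P) := by
  by_cases h : P
  · simp [card_of_pos h]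
  · simp [card_of_neg h]

end Column

open Column

variable {A : Type*}

/-- The edges of a column graph, each listed in one direction. The `rail` and `mid` vertices of a
column form a triangle, each `spur` vertex is joined to the corresponding `rail` vertex and to the
other `spur` vertex, and only the `spur` vertex labelled `true` is joined to `mid`. The two rails
and the `mid` vertices carry copies of `G`. -/
inductive ColumnStep (G : SimpleGraph A) (S : A → Prop) :
    (Σ a, Column (S a)) → (Σ a, Column (S a)) → Prop
  | rail_rail (b : Bool) (a : A) : ColumnStep G S ⟨a, rail b⟩ ⟨a, rail !b⟩
  | rail_mid (b : Bool) (a : A) : ColumnStep G S ⟨a, rail b⟩ ⟨a, mid⟩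
  | rail_spur (b : Bool) (a : A) (h : S a) : ColumnStep G S ⟨a, rail b⟩ ⟨a, spur b h⟩
  | spur_spur (b : Bool) (a : A) (h : S a) : ColumnStep G S ⟨a, spur b h⟩ ⟨a, spur (!b) h⟩
  | spur_mid (a : A) (h : S a) : ColumnStep G S ⟨a, spur true h⟩ ⟨a, mid⟩
  | rail_lift (b : Bool) {a a' : A} (h : G.Adj a a') : ColumnStep G S ⟨a, rail b⟩ ⟨a', rail b⟩
  | mid_lift {a a' : A} (h : G.Adj a a') : ColumnStep G S ⟨a, mid⟩ ⟨a', mid⟩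

/-- The graph obtained from `G` by replacing each vertex `a` by a column of three vertices, or of
five vertices if `S a` holds. -/
def columnGraph (G : SimpleGraph A) (S : A → Prop) : SimpleGraph (Σ a, Column (S a)) :=
  SimpleGraph.fromRel (ColumnStep G S)

variable {G : SimpleGraph A} {S : A → Prop}

theorem ColumnStep.adj {w w' : Σ a, Column (S a)} (h : ColumnStep G S w w') :
    (columnGraph G S).Adj w w' := by
  refine (SimpleGraph.fromRel_adj _ _ _).2 ⟨?_, Or.inl h⟩
  cases h with
  | rail_lift b h | mid_lift h => simp [h.ne]
  | _ => simp

/-- The number of vertices of a column graph in the columns listed in `l`. -/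
noncomputable def columnsCard (S : A → Prop) (l : List A) : ℕ :=
  (l.map fun a => Nat.card (Column (S a))).sum

theorem columnsCard_nil : columnsCard S [] = 0 := rfl

theorem columnsCard_cons_of_pos {a : A} (h : S a) (l : List A) :
    columnsCard S (a :: l) = columnsCard S l + 5 := by
  simp [columnsCard, card_of_pos h, add_comm]

theorem columnsCard_cons_of_neg {a : A} (h : ¬ S a) (l : List A) :
    columnsCard S (a :: l) = columnsCard S l + 3 := by
  simp [columnsCard, card_of_neg h, add_comm]

theorem three_le_columnsCard_support {a a' : A} (p : G.Walk a a') :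
    3 ≤ columnsCard S p.support := by
  rw [← Walk.cons_tail_support, columnsCard, List.map_cons, List.sum_cons]
  exact le_add_right (three_le_card _)

theorem card_eq_columnsCard [Finite A] [DecidableEq A] {a a' : A} {p : G.Walk a a'}
    (hp : p.IsHamiltonian) : Nat.card (Σ a, Column (S a)) = columnsCard S p.support := by
  have := Fintype.ofFinite A
  rw [Nat.card_sigma, ← hp.toFinset_support, List.sum_toFinset _ hp.isPath.support_nodup,
    columnsCard]

/-- Inside the column of `a`, some path with `j` vertices runs from the rail vertex `b` to the rail
vertex `b'` and avoids the `mid` vertex. -/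
def HasSegment (G : SimpleGraph A) (S : A → Prop) (a : A) (b b' : Bool) (j : ℕ) : Prop :=
  ∃ p : (columnGraph G S).Walk ⟨a, rail b⟩ ⟨a, rail b'⟩,
    p.IsPath ∧ p.length + 1 = j ∧ ∀ w ∈ p.support, w.1 = a ∧ w ≠ ⟨a, mid⟩

theorem hasSegment_one (a : A) (b : Bool) : HasSegment G S a b b 1 :=
  ⟨.nil, by simp, by simp, by simp⟩

theorem hasSegment_two (a : A) (b : Bool) : HasSegment G S a b (!b) 2 :=
  ⟨.cons (ColumnStep.rail_rail b a).adj .nil, by simp, by simp, by simp⟩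

theorem hasSegment_four {a : A} (h : S a) (b : Bool) : HasSegment G S a b (!b) 4 :=
  ⟨.cons (ColumnStep.rail_spur b a h).adj (.cons (ColumnStep.spur_spur b a h).adj
    (.cons (ColumnStep.rail_spur (!b) a h).adj.symm .nil)), by simp, by simp, by simp⟩

/-- Inside the columns listed in `l`, some path with `k` vertices runs from the rail vertex `b` of
the column of `a` to the `mid` vertex of the same column. -/
def HasTraversal (G : SimpleGraph A) (S : A → Prop) (l : List A) (a : A) (b : Bool) (k : ℕ) :
    Prop :=
  ∃ p : (columnGraph G S).Walk ⟨a, rail b⟩ ⟨a, mid⟩,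
    p.IsPath ∧ p.length + 1 = k ∧ ∀ w ∈ p.support, w.1 ∈ l

theorem HasSegment.hasTraversal {a : A} {b b' : Bool} {j : ℕ} (h : HasSegment G S a b b' j)
    (l : List A) : HasTraversal G S (a :: l) a b (j + 1) := by
  obtain ⟨p, hp, rfl, hcol⟩ := h
  refine ⟨p.concat (ColumnStep.rail_mid b' a).adj, hp.concat (fun hm => (hcol _ hm).2 rfl) _,
    by simp, fun w hw => ?_⟩
  rw [Walk.support_concat, List.mem_append, List.mem_singleton] at hw
  rcases hw with hw | rfl
  · simp [(hcol w hw).1]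
  · simp

theorem HasTraversal.cons {l : List A} {a a' : A} {b b' : Bool} {j k : ℕ}
    (hk : HasTraversal G S l a' b' k) (hj : HasSegment G S a b b' j) (h : G.Adj a a')
    (ha : a ∉ l) : HasTraversal G S (a :: l) a b (k + (j + 1)) := by
  obtain ⟨p, hp, rfl, hpcol⟩ := hj
  obtain ⟨q, hq, rfl, hqcol⟩ := hk
  have hq_notMem {w : Σ a, Column (S a)} (hw : w.1 = a) : w ∉ q.support :=
    fun hm => ha (hw ▸ hqcol w hm)
  have hq' := hq.concat (hq_notMem (w := ⟨a, mid⟩) rfl) (ColumnStep.mid_lift h.symm).adj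
  refine ⟨p.append (.cons (ColumnStep.rail_lift b' h).adj
      (q.concat (ColumnStep.mid_lift h.symm).adj)),
    isPath_append_cons hp hq' _ fun w hwp hwq => ?_, by simp; omega, fun w hw => ?_⟩
  · rw [Walk.support_concat, List.mem_append, List.mem_singleton] at hwq
    exact hwq.elim (hq_notMem (hpcol w hwp).1) (hpcol w hwp).2
  · simp only [Walk.support_append, Walk.support_cons, List.tail_cons, Walk.support_concat,
      List.mem_append, List.mem_singleton] at hw
    rcases hw with hw | hw | rfl
    · simp [(hpcol w hw).1]
    · exact List.mem_cons_of_mem _ (hqcol w hw)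
    · simp

/-- The numbers `k` of vertices, out of `m`, that a traversal can be given from either rail. When
all columns have five vertices, missing exactly one vertex requires the edge between `spur true` and
`mid` in the last column, which dictates the rail to start from. -/
def IsBothRailsLength (m k : ℕ) : Prop :=
  2 ≤ k ∧ k ≤ m ∧ (k + 1 ≠ m ∨ k = 2)

theorem IsBothRailsLength.exists_eq_add {m k : ℕ} (hm : 3 ≤ m) (hk4 : 4 ≤ k) (hk : k ≤ m + 3) :
    ∃ k', IsBothRailsLength m k' ∧ (k = k' + 2 ∨ k = k' + 3) := by
  simp only [IsBothRailsLength]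
  by_cases hadd : k = m + 3 ∨ (k = m + 1 ∧ 5 ≤ k)
  · exact ⟨k - 3, by omega, by omega⟩
  · exact ⟨k - 2, by omega, by omega⟩

theorem hasTraversal_cons_of_le_add_three {l : List A} {a a' : A} {m k : ℕ}
    (hl : ∀ k', IsBothRailsLength m k' → ∀ b, HasTraversal G S l a' b k') (h : G.Adj a a')
    (ha : a ∉ l) (hm : 3 ≤ m) (hk2 : 2 ≤ k) (hk : k ≤ m + 3) (b : Bool) :
    HasTraversal G S (a :: l) a b k := by
  obtain rfl | rfl | hk4 : k = 2 ∨ k = 3 ∨ 4 ≤ k := by omega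
  · exact (hasSegment_one a b).hasTraversal l
  · exact (hasSegment_two a b).hasTraversal l
  · obtain ⟨k', hk', rfl | rfl⟩ := IsBothRailsLength.exists_eq_add hm hk4 hk
    · exact (hl k' hk' b).cons (hasSegment_one a b) h ha
    · exact (hl k' hk' !b).cons (hasSegment_two a b) h ha

theorem hasTraversal_support {a a' : A} {p : G.Walk a a'} (hp : p.IsPath) {k : ℕ}
    (hk : IsBothRailsLength (columnsCard S p.support) k) (b : Bool) :
    HasTraversal G S p.support a b k := by
  induction p generalizing k b with
  | @nil a =>
    rw [Walk.support_nil] at hk ⊢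
    obtain ⟨hk2, hkm, hgap⟩ := hk
    obtain rfl | rfl | hk4 : k = 2 ∨ k = 3 ∨ 4 ≤ k := by omega
    · exact (hasSegment_one a b).hasTraversal []
    · exact (hasSegment_two a b).hasTraversal []
    by_cases hS : S a
    · rw [columnsCard_cons_of_pos hS, columnsCard_nil] at hkm hgap
      obtain rfl : k = 5 := by omega
      exact (hasSegment_four hS b).hasTraversal []
    · rw [columnsCard_cons_of_neg hS, columnsCard_nil] at hkm
      omega
  | @cons a a₁ _ h p ih =>
    rw [Walk.cons_isPath_iff] at hp
    rw [Walk.support_cons] at hk ⊢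
    obtain ⟨hk2, hkm, hgap⟩ := hk
    have hm : 3 ≤ columnsCard S p.support := three_le_columnsCard_support p
    by_cases hle : k ≤ columnsCard S p.support + 3
    · exact hasTraversal_cons_of_le_add_three (fun _ hk' => ih hp.1 hk') h hp.2 hm hk2 hle b
    by_cases hS : S a
    · rw [columnsCard_cons_of_pos hS] at hkm hgap
      obtain rfl : k = columnsCard S p.support + 5 := by omega
      exact (ih hp.1 ⟨by omega, le_rfl, by omega⟩ !b).cons (hasSegment_four hS b) h hp.2
    · rw [columnsCard_cons_of_neg hS] at hkm
      exact absurd hkm hle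

theorem hasTraversal_singleton_four {a : A} (h : S a) : HasTraversal G S [a] a false 4 :=
  ⟨.cons (ColumnStep.rail_spur false a h).adj (.cons (ColumnStep.spur_spur false a h).adj
    (.cons (ColumnStep.spur_mid a h).adj .nil)), by simp, by simp, by simp⟩

theorem exists_hasTraversal_support_of_add_one_eq {a a' : A} {p : G.Walk a a'} (hp : p.IsPath)
    {k : ℕ} (hk : k + 1 = columnsCard S p.support) : ∃ b, HasTraversal G S p.support a b k := by
  induction p generalizing k with
  | @nil a =>
    rw [Walk.support_nil] at hk ⊢
    by_cases hS : S a
    · rw [columnsCard_cons_of_pos hS, columnsCard_nil] at hk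
      obtain rfl : k = 4 := by omega
      exact ⟨false, hasTraversal_singleton_four hS⟩
    · rw [columnsCard_cons_of_neg hS, columnsCard_nil] at hk
      obtain rfl : k = 2 := by omega
      exact ⟨false, (hasSegment_one a false).hasTraversal []⟩
  | @cons a a₁ _ h p ih =>
    rw [Walk.cons_isPath_iff] at hp
    rw [Walk.support_cons] at hk ⊢
    have hm : 3 ≤ columnsCard S p.support := three_le_columnsCard_support p
    by_cases hS : S a
    · rw [columnsCard_cons_of_pos hS] at hk
      obtain ⟨k', rfl⟩ : ∃ k', k = k' + 5 := ⟨k - 5, by omega⟩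
      obtain ⟨b, hb⟩ := ih hp.1 (k := k') (by omega)
      exact ⟨!b, hb.cons (by simpa using hasSegment_four hS !b) h hp.2⟩
    · rw [columnsCard_cons_of_neg hS] at hk
      obtain rfl : k = columnsCard S p.support + 2 := by omega
      exact ⟨false, (hasTraversal_support hp.1 ⟨by omega, le_rfl, by omega⟩ false).cons
        (hasSegment_one a false) h hp.2⟩

theorem exists_hasTraversal_support {a a' : A} {p : G.Walk a a'} (hp : p.IsPath) {k : ℕ}
    (hk2 : 2 ≤ k) (hk : k ≤ columnsCard S p.support) : ∃ b, HasTraversal G S p.support a b k := by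
  by_cases hgap : k + 1 = columnsCard S p.support
  · exact exists_hasTraversal_support_of_add_one_eq hp hgap
  · exact ⟨false, hasTraversal_support hp ⟨hk2, hk, Or.inl hgap⟩ false⟩

theorem isPancyclic_columnGraph [Finite A] [DecidableEq A] {a a' : A} {p : G.Walk a a'}
    (hp : p.IsHamiltonian) : IsPancyclic (columnGraph G S) := by
  intro k hk3 hk
  rw [card_eq_columnsCard hp] at hk
  obtain ⟨b, q, hq, rfl, -⟩ := exists_hasTraversal_support hp.isPath (by omega) hk
  exact ⟨_, .cons (ColumnStep.rail_mid b a).adj.symm q,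
    isCycle_cons_of_two_le_length hq _ (by omega), by simp⟩

end ColumnGraph

section Dominating

variable {V V' : Type*} {G : SimpleGraph V} {G' : SimpleGraph V'} {x : V} {X Y : Set V}

theorem isDominating_univ (G : SimpleGraph V) : IsDominating G Set.univ :=
  fun w hw => absurd (Set.mem_univ w) hw

theorem IsDominating.mono (hX : IsDominating G X) (hXY : X ⊆ Y) : IsDominating G Y := fun w hw =>
  let ⟨d, hd, hwd⟩ := hX w fun hx => hw (hXY hx)
  ⟨d, hXY hd, hwd⟩

/-- `D` dominates every vertex of `G`, except possibly `x`. -/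
def DominatesExcept (G : SimpleGraph V) (x : V) (D : Set V) : Prop :=
  ∀ w, w ∉ D → w ≠ x → ∃ d ∈ D, G.Adj w d

theorem IsDominating.dominatesExcept (hX : IsDominating G X) (x : V) : DominatesExcept G x X :=
  fun w hw _ => hX w hw

theorem DominatesExcept.isDominating_of_mem (hX : DominatesExcept G x X) (hx : x ∈ X) :
    IsDominating G X :=
  fun w hw => hX w hw fun h => hw (h ▸ hx)

theorem DominatesExcept.isDominating_union (hX : DominatesExcept G x X) :
    IsDominating G (X ∪ {x}) := fun w hw => by
  obtain ⟨d, hd, hwd⟩ := hX w (fun h => hw (Or.inl h)) (fun h => hw (Or.inr h))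
  exact ⟨d, Or.inl hd, hwd⟩

/-- Deleting `x` from `D` leaves `x`, and no other vertex, undominated: the only private neighbour
of `x` with respect to `D` is `x` itself. -/
structure IsSelfPrivate (G : SimpleGraph V) (x : V) (D : Set V) : Prop where
  mem : x ∈ D
  dominatesExcept : DominatesExcept G x (D \ {x})
  not_isDominating : ¬ IsDominating G (D \ {x})

/-- One reconfiguration step of either kind: the adjacency relation of `tarsGraph G`. -/
def TARSStep (G : SimpleGraph V) (X Y : Set V) : Prop :=
  TARStep X Y ∨ TSStep G X Y

theorem TARStep.image {f : V → V'} (hf : Function.Injective f) (h : TARStep X Y) :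
    TARStep (f '' X) (f '' Y) := by
  rcases h with ⟨w, hw, rfl⟩ | ⟨w, hw, rfl⟩
  · exact Or.inl ⟨f w, by rwa [hf.mem_set_image], by rw [Set.image_union, Set.image_singleton]⟩
  · exact Or.inr ⟨f w, by rwa [hf.mem_set_image], by rw [Set.image_sdiff hf, Set.image_singleton]⟩

theorem TSStep.image (f : G ↪g G') (h : TSStep G X Y) : TSStep G' (f '' X) (f '' Y) := by
  obtain ⟨a, ha, b, ⟨hbY, hbX⟩, hab, hY⟩ := h
  refine ⟨f a, Set.mem_image_of_mem f ha, f b, ⟨Set.mem_image_of_mem f hbY, ?_⟩,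
    f.map_adj_iff.2 hab, ?_⟩
  · rwa [f.injective.mem_set_image]
  · rw [hY, Set.image_sdiff f.injective, Set.image_union, Set.image_singleton, Set.image_singleton]

theorem TARSStep.image (f : G ↪g G') (h : TARSStep G X Y) : TARSStep G' (f '' X) (f '' Y) :=
  h.imp (TARStep.image f.injective) (TSStep.image f)

theorem sdiff_singleton_union {s : Set V} {a : V} (ha : a ∉ s) :
    X \ {a} ∪ s = (X ∪ s) \ {a} := by
  rw [Set.union_sdiff_distrib, Set.sdiff_singleton_eq_self ha]

theorem TARStep.union_right {s : Set V} (h : TARStep X Y) (hX : Disjoint X s) (hY : Disjoint Y s) :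
    TARStep (X ∪ s) (Y ∪ s) := by
  rcases h with ⟨w, hw, rfl⟩ | ⟨w, hw, rfl⟩
  · have hws : w ∉ s := hY.notMem_of_mem_left (Or.inr rfl)
    exact Or.inl ⟨w, by simp [hw, hws], Set.union_right_comm ..⟩
  · exact Or.inr ⟨w, Or.inl hw, sdiff_singleton_union (hX.notMem_of_mem_left hw)⟩

theorem TSStep.union_right {s : Set V} (h : TSStep G X Y) (hX : Disjoint X s)
    (hY : Disjoint Y s) : TSStep G (X ∪ s) (Y ∪ s) := by
  obtain ⟨a, ha, b, ⟨hbY, hbX⟩, hab, hXY⟩ := h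
  have hbs : b ∉ s := hY.notMem_of_mem_left hbY
  refine ⟨a, Or.inl ha, b, ⟨Or.inl hbY, by simp [hbX, hbs]⟩, hab, ?_⟩
  rw [hXY, sdiff_singleton_union (hX.notMem_of_mem_left ha), Set.union_right_comm]

theorem TARSStep.union_right {s : Set V} (h : TARSStep G X Y) (hX : Disjoint X s)
    (hY : Disjoint Y s) : TARSStep G (X ∪ s) (Y ∪ s) :=
  h.imp (fun h => h.union_right hX hY) (fun h => h.union_right hX hY)

theorem tarStep_sdiff_singleton (h : x ∈ X) : TARStep X (X \ {x}) :=
  Or.inr ⟨x, h, rfl⟩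

theorem tarStep_singleton_pair {a b : V} (h : b ≠ a) : TARStep {a} {a, b} :=
  Or.inl ⟨b, h, Set.insert_eq a {b}⟩

theorem tsStep_singleton {a b : V} (h : G.Adj a b) : TSStep G {a} {b} := by
  refine ⟨a, rfl, b, ⟨rfl, h.ne'⟩, h, ?_⟩
  simp [h.ne']

theorem exists_tarsGraph_adj (G : SimpleGraph V) [Nontrivial {D : Set V // IsDominating G D}] :
    ∃ X Y, (tarsGraph G).Adj X Y := by
  obtain ⟨X, hX⟩ := exists_ne (⟨Set.univ, isDominating_univ G⟩ : {D : Set V // IsDominating G D})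
  obtain ⟨z, hz⟩ : ∃ z, z ∉ X.1 := by
    simpa [Subtype.ext_iff, Set.eq_univ_iff_forall] using hX
  have hdel : IsDominating G (Set.univ \ {z}) :=
    X.2.mono (Set.subset_sdiff_singleton (Set.subset_univ _) hz)
  exact ⟨⟨_, isDominating_univ G⟩, ⟨_, hdel⟩, Or.inl (tarStep_sdiff_singleton (Set.mem_univ z))⟩

theorem exists_isHamiltonian_tarsGraph [Finite V] [DecidableEq {D : Set V // IsDominating G D}]
    (hG : IsPancyclic (tarsGraph G)) :
    ∃ (X Y : _) (p : (tarsGraph G).Walk X Y), p.IsHamiltonian := by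
  by_cases hcard : 3 ≤ Nat.card {D : Set V // IsDominating G D}
  · obtain ⟨_, c, hc⟩ := hG.exists_isHamiltonianCycle hcard
    exact ⟨_, _, c.tail, hc.isHamiltonian_tail⟩
  rcases subsingleton_or_nontrivial {D : Set V // IsDominating G D} with _ | _
  · exact ⟨⟨_, isDominating_univ G⟩, _, .nil, .of_subsingleton⟩
  · obtain ⟨X, Y, hXY⟩ := exists_tarsGraph_adj G
    exact ⟨X, Y, hXY.toWalk, isHamiltonian_toWalk_of_card_le_two hXY (by omega)⟩

end Dominating

section OperationA

variable {V V' : Type*}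

/-- The data of Operation A: an embedding `φ` of `H'` into `H` onto the subgraph induced by all
vertices other than `u` and `v`, where `N(u) = {φ x, v}` and `N(v) = {u}`. -/
structure OperationA (H : SimpleGraph V) (H' : SimpleGraph V') where
  u : V
  v : V
  x : V'
  φ : H' ↪g H
  range_φ : Set.range φ = {u, v}ᶜ
  neighborSet_u : H.neighborSet u = {φ x, v}
  neighborSet_v : H.neighborSet v = {u}

variable {H : SimpleGraph V} {H' : SimpleGraph V'}

theorem IsOperationA.nonempty_operationA (h : IsOperationA H H') : Nonempty (OperationA H H') := by
  obtain ⟨u, v, x, -, hux, hvx, hu, hv, ⟨e⟩⟩ := h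
  let φ : H' ↪g H := (Embedding.induce ({u, v}ᶜ : Set V)).comp e.toEmbedding
  have hx : x ∈ ({u, v}ᶜ : Set V) := by simp [hux.symm, hvx.symm]
  have hφx : φ (e.symm ⟨x, hx⟩) = x := congrArg Subtype.val (e.apply_symm_apply ⟨x, hx⟩)
  have hrange : Set.range φ = {u, v}ᶜ :=
    (e.surjective.range_comp Subtype.val).trans Subtype.range_val
  exact ⟨⟨u, v, e.symm ⟨x, hx⟩, φ, hrange, by rw [hφx, hu], hv⟩⟩

namespace OperationA

variable (d : OperationA H H')

theorem adj_u_iff {z : V} : H.Adj d.u z ↔ z = d.φ d.x ∨ z = d.v := by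
  rw [← mem_neighborSet, d.neighborSet_u, Set.mem_insert_iff, Set.mem_singleton_iff]

theorem adj_v_iff {z : V} : H.Adj d.v z ↔ z = d.u := by
  rw [← mem_neighborSet, d.neighborSet_v, Set.mem_singleton_iff]

theorem u_ne_v : d.u ≠ d.v :=
  (d.adj_v_iff.2 rfl).ne'

theorem φ_ne_u (y : V') : d.φ y ≠ d.u := fun h => by
  simpa [h] using d.range_φ.subset (Set.mem_range_self y)

theorem φ_ne_v (y : V') : d.φ y ≠ d.v := fun h => by
  simpa [h] using d.range_φ.subset (Set.mem_range_self y)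

theorem eq_u_or_eq_v_or_eq_φ (z : V) : z = d.u ∨ z = d.v ∨ ∃ y, d.φ y = z := by
  have : z ∈ Set.range d.φ ↔ z ∈ ({d.u, d.v}ᶜ : Set V) := by rw [d.range_φ]
  simp only [Set.mem_range, Set.mem_compl_iff, Set.mem_insert_iff, Set.mem_singleton_iff] at this
  tauto

/-- `{u}` or `{u, v}`: the traces on `{u, v}` of the dominating sets of `H` that contain `u`. -/
def tail : Bool → Set V
  | false => {d.u}
  | true => {d.u, d.v}

theorem u_mem_tail (b : Bool) : d.u ∈ d.tail b := by
  cases b <;> simp [tail]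

theorem tail_subset (b : Bool) : d.tail b ⊆ {d.u, d.v} := by
  cases b <;> simp [tail]

theorem singleton_v_subset : ({d.v} : Set V) ⊆ {d.u, d.v} :=
  Set.subset_insert _ _

theorem tail_injective : Function.Injective d.tail := by
  have h : d.tail false ≠ d.tail true := fun h =>
    d.u_ne_v.symm (h.symm.subset (Set.mem_insert_of_mem _ rfl))
  rintro (_ | _) (_ | _) heq
  exacts [rfl, absurd heq h, absurd heq.symm h, rfl]

theorem tail_ne_singleton_v (b : Bool) : d.tail b ≠ {d.v} := fun h =>
  d.u_ne_v (h ▸ d.u_mem_tail b : d.u ∈ ({d.v} : Set V))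

theorem disjoint_image_φ {t : Set V} (ht : t ⊆ {d.u, d.v}) (X : Set V') :
    Disjoint (d.φ '' X) t := by
  refine Set.disjoint_of_subset (Set.image_subset_range _ _) ht ?_
  rw [d.range_φ]
  exact disjoint_compl_left

theorem preimage_image_union {t : Set V} (ht : t ⊆ {d.u, d.v}) (X : Set V') :
    d.φ ⁻¹' (d.φ '' X ∪ t) = X := by
  have : d.φ ⁻¹' t = ∅ :=
    Set.preimage_eq_empty (by simpa using (d.disjoint_image_φ ht Set.univ).symm)
  rw [Set.preimage_union, Set.preimage_image_eq _ d.φ.injective, this, Set.union_empty]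

theorem image_union_inj {X Y : Set V'} {t t' : Set V} (ht : t ⊆ {d.u, d.v})
    (ht' : t' ⊆ {d.u, d.v}) (h : d.φ '' X ∪ t = d.φ '' Y ∪ t') : X = Y ∧ t = t' := by
  obtain rfl : X = Y := by
    rw [← d.preimage_image_union ht X, h, d.preimage_image_union ht']
  refine ⟨rfl, ?_⟩
  rw [← (d.disjoint_image_φ ht X).sup_sdiff_cancel_left,
    ← (d.disjoint_image_φ ht' X).sup_sdiff_cancel_left]
  exact congrArg (· \ d.φ '' X) h

theorem image_preimage_union_inter (D : Set V) :
    d.φ '' (d.φ ⁻¹' D) ∪ D ∩ {d.u, d.v} = D := by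
  rw [Set.image_preimage_eq_inter_range, d.range_φ, Set.union_comm, Set.inter_union_compl]

theorem exists_eq_image_union_tail {D : Set V} (hu : d.u ∈ D) :
    ∃ b, D = d.φ '' (d.φ ⁻¹' D) ∪ d.tail b := by
  by_cases hv : d.v ∈ D
  · refine ⟨true, ?_⟩
    conv_lhs => rw [← d.image_preimage_union_inter D]
    rw [Set.inter_eq_right.2 (Set.pair_subset hu hv), tail]
  · refine ⟨false, ?_⟩
    conv_lhs => rw [← d.image_preimage_union_inter D]
    rw [Set.inter_insert_of_mem hu, Set.inter_singleton_eq_empty.2 hv, insert_empty_eq, tail]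

theorem eq_image_union_singleton_v {D : Set V} (hD : IsDominating H D) (hu : d.u ∉ D) :
    D = d.φ '' (d.φ ⁻¹' D) ∪ {d.v} := by
  have hv : d.v ∈ D := by
    by_contra hv
    obtain ⟨e, he, hve⟩ := hD _ hv
    exact hu (d.adj_v_iff.1 hve ▸ he)
  conv_lhs => rw [← d.image_preimage_union_inter D]
  rw [Set.inter_insert_of_notMem hu, Set.inter_eq_right.2 (Set.singleton_subset_iff.2 hv)]

theorem isDominating_image_union_singleton_v_iff {X : Set V'} :
    IsDominating H (d.φ '' X ∪ {d.v}) ↔ IsDominating H' X := by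
  constructor
  · intro hD y hy
    obtain ⟨_, ⟨y', hy', rfl⟩ | rfl, hadj⟩ := hD (d.φ y) (by simp [hy, d.φ_ne_v])
    · exact ⟨y', hy', d.φ.map_adj_iff.1 hadj⟩
    · exact absurd (d.adj_v_iff.1 hadj.symm) (d.φ_ne_u y)
  · intro hX w hw
    rcases d.eq_u_or_eq_v_or_eq_φ w with rfl | rfl | ⟨y, rfl⟩
    · exact ⟨d.v, Or.inr rfl, d.adj_u_iff.2 (Or.inr rfl)⟩
    · exact absurd (Or.inr rfl) hw
    · obtain ⟨y', hy', hadj⟩ := hX y fun hy => hw (Or.inl (Set.mem_image_of_mem _ hy))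
      exact ⟨d.φ y', Or.inl (Set.mem_image_of_mem _ hy'), d.φ.map_adj_iff.2 hadj⟩

theorem isDominating_image_union_tail_iff (b : Bool) {X : Set V'} :
    IsDominating H (d.φ '' X ∪ d.tail b) ↔ DominatesExcept H' d.x X := by
  constructor
  · intro hD y hy hyx
    have hφy : d.φ y ∉ d.tail b := fun h => by
      simpa [d.φ_ne_u, d.φ_ne_v] using d.tail_subset b h
    obtain ⟨e, ⟨y', hy', rfl⟩ | he, hadj⟩ := hD (d.φ y) (by simp [hy, hφy])
    · exact ⟨y', hy', d.φ.map_adj_iff.1 hadj⟩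
    · obtain rfl | rfl := d.tail_subset b he
      · simpa [hyx, d.φ_ne_v] using d.adj_u_iff.1 hadj.symm
      · exact absurd (d.adj_v_iff.1 hadj.symm) (d.φ_ne_u y)
  · intro hX w hw
    rcases d.eq_u_or_eq_v_or_eq_φ w with rfl | rfl | ⟨y, rfl⟩
    · exact absurd (Or.inr (d.u_mem_tail b)) hw
    · exact ⟨d.u, Or.inr (d.u_mem_tail b), d.adj_v_iff.2 rfl⟩
    · by_cases hyx : y = d.x
      · exact ⟨d.u, Or.inr (d.u_mem_tail b), (d.adj_u_iff.2 (Or.inl (hyx ▸ rfl))).symm⟩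
      · obtain ⟨y', hy', hadj⟩ := hX y (fun hy => hw (Or.inl (Set.mem_image_of_mem _ hy))) hyx
        exact ⟨d.φ y', Or.inl (Set.mem_image_of_mem _ hy'), d.φ.map_adj_iff.2 hadj⟩

theorem tarsStep_image_union_left (X : Set V') {t t' : Set V} (ht : t ⊆ {d.u, d.v})
    (ht' : t' ⊆ {d.u, d.v}) (h : TARSStep H t t') :
    TARSStep H (d.φ '' X ∪ t) (d.φ '' X ∪ t') := by
  rw [Set.union_comm _ t, Set.union_comm _ t']
  exact h.union_right (d.disjoint_image_φ ht X).symm (d.disjoint_image_φ ht' X).symm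

theorem tarsStep_image_union_right {X Y : Set V'} (h : TARSStep H' X Y) {t : Set V}
    (ht : t ⊆ {d.u, d.v}) : TARSStep H (d.φ '' X ∪ t) (d.φ '' Y ∪ t) :=
  (h.image d.φ).union_right (d.disjoint_image_φ ht X) (d.disjoint_image_φ ht Y)

theorem tarsStep_tail_not (b : Bool) : TARSStep H (d.tail b) (d.tail !b) := by
  have h : TARStep (d.tail false) (d.tail true) := tarStep_singleton_pair d.u_ne_v.symm
  cases b
  · exact Or.inl h
  · exact Or.inl h.symm

theorem tarsStep_tail_singleton_v (b : Bool) : TARSStep H (d.tail b) {d.v} := by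
  cases b
  · exact Or.inr (tsStep_singleton (d.adj_v_iff.2 rfl).symm)
  · refine Or.inl (TARStep.symm ?_)
    rw [tail, Set.pair_comm]
    exact tarStep_singleton_pair d.u_ne_v

theorem tarsStep_image_union_tail_true_singleton_v {X : Set V'} (hx : d.x ∈ X) :
    TARSStep H (d.φ '' (X \ {d.x}) ∪ d.tail true) (d.φ '' X ∪ {d.v}) := by
  have hslide : TARSStep H {d.u} {d.φ d.x} :=
    Or.inr (tsStep_singleton (d.adj_u_iff.2 (Or.inl rfl)))
  have hu : Disjoint {d.u} (d.φ '' (X \ {d.x}) ∪ {d.v}) := by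
    simp [d.φ_ne_u, d.u_ne_v]
  have hφx : Disjoint {d.φ d.x} (d.φ '' (X \ {d.x}) ∪ {d.v}) := by
    simp [d.φ_ne_v]
  convert hslide.union_right hu hφx using 1
  · rw [Set.union_left_comm, Set.singleton_union, tail]
  · rw [← Set.union_assoc, ← Set.image_singleton (f := d.φ), ← Set.image_union, Set.singleton_union,
      Set.insert_sdiff_singleton, Set.insert_eq_of_mem hx]

/-- The set of vertices of `H` encoded by a vertex of the column of `X`. -/
def columnSet (X : Set V') : Column (IsSelfPrivate H' d.x X) → Set V
  | .rail b => d.φ '' X ∪ d.tail b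
  | .mid => d.φ '' X ∪ {d.v}
  | .spur b _ => d.φ '' (X \ {d.x}) ∪ d.tail b

theorem isDominating_columnSet {X : Set V'} (hX : IsDominating H' X) :
    ∀ c : Column (IsSelfPrivate H' d.x X), IsDominating H (d.columnSet X c)
  | .rail b => (d.isDominating_image_union_tail_iff b).2 (hX.dominatesExcept d.x)
  | .mid => d.isDominating_image_union_singleton_v_iff.2 hX
  | .spur b h => (d.isDominating_image_union_tail_iff b).2 h.dominatesExcept

/-- The columns of `H`, one for each dominating set of `H'`. -/
abbrev Columns :=
  Σ X : {D : Set V' // IsDominating H' D}, Column (IsSelfPrivate H' d.x X.1)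

/-- The dominating set of `H` encoded by a vertex of a column. -/
def columnsSet (w : d.Columns) : {D : Set V // IsDominating H D} :=
  ⟨d.columnSet w.1.1 w.2, d.isDominating_columnSet w.1.2 w.2⟩

theorem tarsGraph_adj_columnsSet {w w' : d.Columns}
    (h : ColumnStep (tarsGraph H') (fun X => IsSelfPrivate H' d.x X.1) w w') :
    (tarsGraph H).Adj (d.columnsSet w) (d.columnsSet w') := by
  cases h with
  | rail_rail b X =>
    exact d.tarsStep_image_union_left X.1 (d.tail_subset b) (d.tail_subset _)
      (d.tarsStep_tail_not b)
  | rail_mid b X =>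
    exact d.tarsStep_image_union_left X.1 (d.tail_subset b) d.singleton_v_subset
      (d.tarsStep_tail_singleton_v b)
  | rail_spur b X h =>
    exact d.tarsStep_image_union_right (Or.inl (tarStep_sdiff_singleton h.mem)) (d.tail_subset b)
  | spur_spur b X h =>
    exact d.tarsStep_image_union_left (X.1 \ {d.x}) (d.tail_subset b) (d.tail_subset _)
      (d.tarsStep_tail_not b)
  | spur_mid X h => exact d.tarsStep_image_union_tail_true_singleton_v h.mem
  | rail_lift b h => exact d.tarsStep_image_union_right h (d.tail_subset b)
  | mid_lift h => exact d.tarsStep_image_union_right h d.singleton_v_subset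

/-- The encoding of the dominating sets of `H`, as a homomorphism from the column graph over the
TARS-graph of `H'`. -/
def columnHom :
    columnGraph (tarsGraph H') (fun X => IsSelfPrivate H' d.x X.1) →g tarsGraph H where
  toFun := d.columnsSet
  map_rel' h := ((SimpleGraph.fromRel_adj _ _ _).1 h).2.elim d.tarsGraph_adj_columnsSet
    fun h => (d.tarsGraph_adj_columnsSet h).symm

theorem columnHom_injective : Function.Injective d.columnHom := by
  rintro ⟨X, c⟩ ⟨Y, c'⟩ h
  replace h : d.columnSet X.1 c = d.columnSet Y.1 c' := congrArg Subtype.val h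
  rcases c with b | _ | ⟨b, hX⟩ <;> rcases c' with b' | _ | ⟨b', hY⟩
  · obtain ⟨hXY, hb⟩ := d.image_union_inj (d.tail_subset b) (d.tail_subset b') h
    obtain rfl := Subtype.ext hXY
    rw [d.tail_injective hb]
  · have := (d.image_union_inj (d.tail_subset b) d.singleton_v_subset h).2
    exact absurd this (d.tail_ne_singleton_v b)
  · have hXY := (d.image_union_inj (d.tail_subset b) (d.tail_subset b') h).1
    exact absurd (hXY ▸ X.2) hY.not_isDominating
  · have := (d.image_union_inj d.singleton_v_subset (d.tail_subset b') h).2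
    exact absurd this.symm (d.tail_ne_singleton_v b')
  · have hXY := (d.image_union_inj d.singleton_v_subset d.singleton_v_subset h).1
    obtain rfl := Subtype.ext hXY
    rfl
  · have := (d.image_union_inj d.singleton_v_subset (d.tail_subset b') h).2
    exact absurd this.symm (d.tail_ne_singleton_v b')
  · have hXY := (d.image_union_inj (d.tail_subset b) (d.tail_subset b') h).1
    exact absurd (hXY ▸ Y.2) hX.not_isDominating
  · have := (d.image_union_inj (d.tail_subset b) d.singleton_v_subset h).2
    exact absurd this (d.tail_ne_singleton_v b)
  · obtain ⟨hXY, hb⟩ := d.image_union_inj (d.tail_subset b) (d.tail_subset b') h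
    have : X.1 = Y.1 := by
      rw [← Set.insert_sdiff_self_of_mem hX.mem, hXY, Set.insert_sdiff_self_of_mem hY.mem]
    obtain rfl := Subtype.ext this
    rw [d.tail_injective hb]

theorem columnHom_surjective : Function.Surjective d.columnHom := by
  rintro ⟨D, hD⟩
  suffices ∃ w : d.Columns, d.columnSet w.1.1 w.2 = D from this.imp fun w hw => Subtype.ext hw
  by_cases hu : d.u ∈ D
  · obtain ⟨b, hb⟩ := d.exists_eq_image_union_tail hu
    have hdom : DominatesExcept H' d.x (d.φ ⁻¹' D) :=
      (d.isDominating_image_union_tail_iff b).1 (hb ▸ hD)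
    by_cases hD' : IsDominating H' (d.φ ⁻¹' D)
    · exact ⟨⟨⟨_, hD'⟩, .rail b⟩, hb.symm⟩
    · have hx : d.x ∉ d.φ ⁻¹' D := fun hx => hD' (hdom.isDominating_of_mem hx)
      have hdel : (d.φ ⁻¹' D ∪ {d.x}) \ {d.x} = d.φ ⁻¹' D := by
        rw [Set.union_sdiff_right, Set.sdiff_singleton_eq_self hx]
      refine ⟨⟨⟨_, hdom.isDominating_union⟩, .spur b ⟨Or.inr rfl, ?_, ?_⟩⟩, ?_⟩
      · rwa [hdel]
      · rwa [hdel]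
      · rw [columnSet, hdel, ← hb]
  · have hv := d.eq_image_union_singleton_v hD hu
    exact ⟨⟨⟨_, d.isDominating_image_union_singleton_v_iff.1 (hv ▸ hD)⟩, .mid⟩, hv.symm⟩

end OperationA
end OperationA
end TARS

theorem mainTheorem11_general {V V' : Type*} [Finite V] {H : SimpleGraph V}
    {H' : SimpleGraph V'} (hA : TARS.IsOperationA H H')
    [DecidableEq {D : Set V' // TARS.IsDominating H' D}]
    {X Y : {D : Set V' // TARS.IsDominating H' D}} {p : (TARS.tarsGraph H').Walk X Y}
    (hp : p.IsHamiltonian) : TARS.IsPancyclic (TARS.tarsGraph H) := by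
  obtain ⟨d⟩ := hA.nonempty_operationA
  have := hp.finite
  exact (TARS.isPancyclic_columnGraph hp).map d.columnHom
    ⟨d.columnHom_injective, d.columnHom_surjective⟩

theorem mainTheorem11 {V V' : Type*} [Finite V] [Finite V']
    (H : SimpleGraph V) (H' : SimpleGraph V') (hA : TARS.IsOperationA H H')
    (hH' : TARS.IsPancyclic (TARS.tarsGraph H')) :
    TARS.IsPancyclic (TARS.tarsGraph H) := by
  classical
  obtain ⟨_, _, _, hp⟩ := TARS.exists_isHamiltonian_tarsGraph hH'
  exact mainTheorem11_general hA hp
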